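/- Let $n\ge 1$, $m\ge 2$ be integers and $s\in\mathbb{R}\setminus\{0\}$. A convex body is a compact convex subset of $\mathbb{R}^n$; let $K,K_1,\dots,K_m$ be convex bodies in $\mathbb{R}^n$ with the origin in their interiors. Write $h_L(u)=\max_{x\in L}\langle x,u\rangle$, $u\in S^{n-1}$, for the support function of $L$, let $S_K$ be the surface area measure of $K$ on $S^{n-1}$ (the image of the $(n-1)$-dimensional Hausdorff measure on $\partial K$ under the Gauss map), and let $$V_s(K,L)=\frac1n\int_{S^{n-1}}h_L^s(u)\,h_K^{1-s}(u)\,dS_K(u)$$ be the $L_s$ mixed volume. Let $\Phi_m$ be the set of continuous $\varphi:[0,\infty)^m\to[0,\infty)$ that are strictly increasing in each component with $\varphi(o)=0$ and $\lim_{t\to\infty}\varphi(tz)=\infty$ for every nonzero $z\in[0,\infty)^m$. Let $\Psi_m$ be the set of continuous $\varphi:(0,\infty)^m\to(0,\infty)$ that are strictly decreasing in each component with $\lim_{t\to0^+}\varphi(tz)=\infty$ and $\lim_{t\to\infty}\varphi(tz)=0$ for every $z\in(0,\infty)^m$. For $\varphi\in\Phi_m\cup\Psi_m$ put $\varphi_s(z)=\varphi(z_1^{1/s},\dots,z_m^{1/s})$,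 $z\in(0,\infty)^m$. The Orlicz sum $+_\varphi(K_1,\dots,K_m)$ is given by its support function $h=h_{+_\varphi(K_1,\dots,K_m)}$, where for each $u\in S^{n-1}$ the number $h(u)>0$ is the unique solution of $$\varphi\Big(\frac{h_{K_1}(u)}{h(u)},\dots,\frac{h_{K_m}(u)}{h(u)}\Big)=1,$$ and $V_s(K,+_\varphi(K_1,\dots,K_m))=\frac1n\int_{S^{n-1}}h^s\,h_K^{1-s}\,dS_K$. (If $h$ is not the support function of a convex body, $V_s(K,+_\varphi(K_1,\dots,K_m))$ stands for this integral.) Let $\varphi\in\Phi_m\cup\Psi_m$. Then the numbers $V_s(K,K_j)$ and $V_s(K,+_\varphi(K_1,\dots,K_m))$ are positive and finite. If $\varphi_s$ is concave on $(0,\infty)^m$, then $$\varphi_s\Big(\frac{V_s(K,K_1)}{V_s(K,+_\varphi(K_1,\dots,K_m))},\dots,\frac{V_s(K,K_m)}{V_s(K,+_\varphi(K_1,\dots,K_m))}\Big)\ge 1 ,$$ and if $\varphi_s$ is convex on $(0,\infty)^m$, the inequality holds with $\ge$ replaced by $\le$. If $\varphi_s$ is strictly concave or strictly convex on $(0,\infty)^m$,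 equality holds if and only if there are constants $a_j>0$ such that $h_{K_j}=a_jh_{K_1}$ on the support of $S_K$ for all $2\le j\le m$. In particular, if the support of $S_K$ is all of $S^{n-1}$, equality holds if and only if there are constants $a_j>0$ such that $h_{K_j}=a_jh_{K_1}$ on $S^{n-1}$ for all $2\le j\le m$. -/

import Mathlib

open Set Filter Topology MeasureTheory
open scoped RealInnerProductSpace

/-! ### Orlicz functions -/

/-- The closed orthant `[0, ∞)^m`. -/
def closedOrthant (m : ℕ) : Set (Fin m → ℝ) := {z | ∀ i, 0 ≤ z i}

/-- The open orthant `(0, ∞)^m`. -/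
def openOrthant (m : ℕ) : Set (Fin m → ℝ) := {z | ∀ i, 0 < z i}

/-- The class `Φ_m`: continuous functions `φ : [0, ∞)^m → [0, ∞)`, strictly increasing in each
component, with `φ 0 = 0` and `φ (t z) → ∞` as `t → ∞` for every nonzero `z`.
Only the values of `φ` on `[0, ∞)^m` matter. -/
structure IsOrliczPhi {m : ℕ} (φ : (Fin m → ℝ) → ℝ) : Prop where
  continuousOn : ContinuousOn φ (closedOrthant m)
  nonneg : ∀ z ∈ closedOrthant m, 0 ≤ φ z
  strictMono : ∀ z ∈ closedOrthant m, ∀ j, ∀ t, z j < t → φ z < φ (Function.update z j t)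
  map_zero : φ 0 = 0
  tendsto_atTop : ∀ z ∈ closedOrthant m, z ≠ 0 → Tendsto (fun t : ℝ => φ (t • z)) atTop atTop

/-- The class `Ψ_m`: continuous functions `φ : (0, ∞)^m → (0, ∞)`, strictly decreasing in each
component, with `φ (t z) → ∞` as `t → 0⁺` and `φ (t z) → 0` as `t → ∞` for every `z`.
Only the values of `φ` on `(0, ∞)^m` matter. -/
structure IsOrliczPsi {m : ℕ} (φ : (Fin m → ℝ) → ℝ) : Prop where
  continuousOn : ContinuousOn φ (openOrthant m)
  pos : ∀ z ∈ openOrthant m, 0 < φ z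
  strictAnti : ∀ z ∈ openOrthant m, ∀ j, ∀ t, z j < t → φ (Function.update z j t) < φ z
  tendsto_zero : ∀ z ∈ openOrthant m, Tendsto (fun t : ℝ => φ (t • z)) (𝓝[>] 0) atTop
  tendsto_atTop : ∀ z ∈ openOrthant m, Tendsto (fun t : ℝ => φ (t • z)) atTop (𝓝 0)

/-- `φ_s (z) = φ (z₁^{1/s}, …, z_m^{1/s})`. -/
noncomputable def orliczPow {m : ℕ} (s : ℝ) (φ : (Fin m → ℝ) → ℝ) (z : Fin m → ℝ) : ℝ :=
  φ (fun j => z j ^ (1 / s))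

open Classical in
/-- The Orlicz addition `+_φ (p₁, …, p_m)` of nonnegative functions: its value at `x` is the
unique `q > 0` with `φ (p₁ x / q, …, p_m x / q) = 1`, and `0` if there is none (for `φ ∈ Φ_m`
that happens exactly when all `p_j x` vanish). See `existsUnique_orlicz_of_phi` and
`existsUnique_orlicz_of_psi` for existence and uniqueness. -/
noncomputable def orliczSum {m : ℕ} {X : Type*} (φ : (Fin m → ℝ) → ℝ) (p : Fin m → X → ℝ)
    (x : X) : ℝ :=
  if h : ∃ q : ℝ, 0 < q ∧ φ (fun j => p j x / q) = 1 then h.choose else 0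

/-! ### Convex bodies: support function, surface area measure, `L_s` mixed volume -/

/-- The support function `h_K (u) = max_{x ∈ K} ⟨x, u⟩`. -/
noncomputable def supportFun {n : ℕ} (K : ConvexBody (EuclideanSpace ℝ (Fin n)))
    (u : Metric.sphere (0 : EuclideanSpace ℝ (Fin n)) 1) : ℝ :=
  sSup ((fun x => ⟪x, (u : EuclideanSpace ℝ (Fin n))⟫) '' (K : Set (EuclideanSpace ℝ (Fin n))))

/-- `u` is an outer unit normal vector of `K` at `x`. -/
def IsOuterNormal {n : ℕ} (K : ConvexBody (EuclideanSpace ℝ (Fin n)))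
    (x : EuclideanSpace ℝ (Fin n)) (u : Metric.sphere (0 : EuclideanSpace ℝ (Fin n)) 1) : Prop :=
  ∀ y ∈ K, ⟪y, (u : EuclideanSpace ℝ (Fin n))⟫ ≤ ⟪x, (u : EuclideanSpace ℝ (Fin n))⟫

/-- The regular boundary points of `K`: those with exactly one outer unit normal vector. -/
def regularBoundary {n : ℕ} (K : ConvexBody (EuclideanSpace ℝ (Fin n))) :
    Set (EuclideanSpace ℝ (Fin n)) :=
  {x | x ∈ frontier (K : Set (EuclideanSpace ℝ (Fin n))) ∧ ∃! u, IsOuterNormal K x u}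

/-- The Gauss map, sending a regular boundary point to its outer unit normal vector. -/
noncomputable def gaussMap {n : ℕ} (K : ConvexBody (EuclideanSpace ℝ (Fin n)))
    (x : regularBoundary K) : Metric.sphere (0 : EuclideanSpace ℝ (Fin n)) 1 :=
  x.2.2.choose

/-- The surface area measure `S_K` on the unit sphere: the image of the `(n-1)`-dimensional
Hausdorff measure on the regular boundary under the Gauss map. The measure `μHE[d]` is normalised
so that it agrees with Lebesgue measure on `ℝ^d`; on a subset of `ℝ^n`, seen as a metric space,
it is the restriction of the one on `ℝ^n`. -/
noncomputable def surfaceAreaMeasure {n : ℕ} (K : ConvexBody (EuclideanSpace ℝ (Fin n))) :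
    Measure (Metric.sphere (0 : EuclideanSpace ℝ (Fin n)) 1) :=
  Measure.map (gaussMap K) (Measure.euclideanHausdorffMeasure (n - 1))

/-- The `L_s` mixed volume `(1/n) ∫ f^s h_K^{1-s} dS_K` of `K` and of an object whose support
function is `f`. -/
noncomputable def mixedVolumeFun {n : ℕ} (s : ℝ) (K : ConvexBody (EuclideanSpace ℝ (Fin n)))
    (f : Metric.sphere (0 : EuclideanSpace ℝ (Fin n)) 1 → ℝ) : ℝ :=
  (1 / (n : ℝ)) * ∫ u, f u ^ s * supportFun K u ^ (1 - s) ∂(surfaceAreaMeasure K)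

/-- The `L_s` mixed volume `V_s (K, L) = (1/n) ∫ h_L^s h_K^{1-s} dS_K`. -/
noncomputable def mixedVolume {n : ℕ} (s : ℝ) (K L : ConvexBody (EuclideanSpace ℝ (Fin n))) : ℝ :=
  mixedVolumeFun s K (supportFun L)

/-- `V_s (K, +_φ (K₁, …, K_m))`, where `+_φ (K₁, …, K_m)` is given by its support function, the
solution `h` of `φ (h_{K₁} / h, …, h_{K_m} / h) = 1`. -/
noncomputable def mixedVolumeOrlicz {n m : ℕ} (s : ℝ) (K : ConvexBody (EuclideanSpace ℝ (Fin n)))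
    (φ : (Fin m → ℝ) → ℝ) (L : Fin m → ConvexBody (EuclideanSpace ℝ (Fin n))) : ℝ :=
  mixedVolumeFun s K (orliczSum φ (fun j => supportFun (L j)))

/-! ### The definitions are meaningful -/

theorem gaussMap_spec {n : ℕ} (K : ConvexBody (EuclideanSpace ℝ (Fin n)))
    (x : regularBoundary K) (u : Metric.sphere (0 : EuclideanSpace ℝ (Fin n)) 1) :
    IsOuterNormal K x u ↔ u = gaussMap K x :=
  ⟨fun h => x.2.2.choose_spec.2 u h, fun h => h ▸ x.2.2.choose_spec.1⟩

/-- The Gauss map is continuous, so that the image measure above is not a default value. -/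
theorem continuous_gaussMap {n : ℕ} (K : ConvexBody (EuclideanSpace ℝ (Fin n))) :
    Continuous (gaussMap K) := by
  rw [continuous_iff_isClosed]
  intro C hC
  have hcl : IsClosed {p : regularBoundary K × Metric.sphere (0 : EuclideanSpace ℝ (Fin n)) 1 |
      p.2 ∈ C ∧ IsOuterNormal K p.1 p.2} := by
    refine (hC.preimage continuous_snd).inter ?_
    have : {p : regularBoundary K × Metric.sphere (0 : EuclideanSpace ℝ (Fin n)) 1 |
        IsOuterNormal K p.1 p.2} = ⋂ y ∈ K, {p | ⟪y, (p.2 : EuclideanSpace ℝ (Fin n))⟫ ≤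
          ⟪(p.1 : EuclideanSpace ℝ (Fin n)), (p.2 : EuclideanSpace ℝ (Fin n))⟫} := by
      ext p; simp [IsOuterNormal]
    change IsClosed {p : regularBoundary K × Metric.sphere (0 : EuclideanSpace ℝ (Fin n)) 1 |
        IsOuterNormal K p.1 p.2}
    rw [this]
    refine isClosed_iInter fun y => isClosed_iInter fun _ => isClosed_le ?_ ?_ <;> fun_prop
  have := isClosedMap_fst_of_compactSpace _ hcl
  convert this using 1
  ext x
  constructor
  · intro hx
    exact ⟨(x, gaussMap K x), ⟨hx, (gaussMap_spec K x _).2 rfl⟩, rfl⟩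
  · rintro ⟨⟨y, u⟩, ⟨hu, hn⟩, rfl⟩
    have := (gaussMap_spec K y u).1 hn
    simpa [← this] using hu

theorem lt_of_le_of_ne_of_update {m : ℕ} {S : Set (Fin m → ℝ)} {f : (Fin m → ℝ) → ℝ}
    (hS : ∀ z ∈ S, ∀ j, ∀ t, z j < t → Function.update z j t ∈ S)
    (hf : ∀ z ∈ S, ∀ j, ∀ t, z j < t → f z < f (Function.update z j t))
    {z w : Fin m → ℝ} (hz : z ∈ S) (hzw : z ≤ w) (hne : z ≠ w) : f z < f w := by
  classical
  have key : ∀ A : Finset (Fin m), A.piecewise w z ∈ S ∧ f z ≤ f (A.piecewise w z) ∧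
      ((∃ j ∈ A, z j < w j) → f z < f (A.piecewise w z)) := by
    intro A
    induction A using Finset.induction_on with
    | empty => simp [hz]
    | insert a A ha ih =>
      obtain ⟨h1, h2, h3⟩ := ih
      rw [Finset.piecewise_insert]
      have hval : A.piecewise w z a = z a := Finset.piecewise_eq_of_notMem _ _ _ ha
      rcases (hzw a).lt_or_eq with hlt | heq
      · have h4 : A.piecewise w z a < w a := by rw [hval]; exact hlt
        have h5 := hf _ h1 a _ h4
        exact ⟨hS _ h1 a _ h4, (h2.trans_lt h5).le, fun _ => h2.trans_lt h5⟩
      · have h4 : Function.update (A.piecewise w z) a (w a) = A.piecewise w z := by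
          rw [← heq, ← hval, Function.update_eq_self]
        rw [h4]
        refine ⟨h1, h2, ?_⟩
        rintro ⟨j, hj, hjlt⟩
        rcases Finset.mem_insert.1 hj with rfl | hj
        · exact absurd heq hjlt.ne
        · exact h3 ⟨j, hj, hjlt⟩
  obtain ⟨j, hj⟩ := Function.ne_iff.1 hne
  have := (key Finset.univ).2.2 ⟨j, Finset.mem_univ j, lt_of_le_of_ne (hzw j) hj⟩
  simpa using this

theorem existsUnique_orlicz_of_phi {m : ℕ} {φ : (Fin m → ℝ) → ℝ} (hφ : IsOrliczPhi φ)
    {z : Fin m → ℝ} (hz : z ∈ closedOrthant m) (hz0 : z ≠ 0) :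
    ∃! q : ℝ, 0 < q ∧ φ (fun j => z j / q) = 1 := by
  have hmono : ∀ a b : ℝ, 0 ≤ a → a < b → φ (a • z) < φ (b • z) := by
    intro a b ha hab
    refine lt_of_le_of_ne_of_update (S := closedOrthant m) ?_ hφ.strictMono ?_ ?_ ?_
    · intro z hz j t ht i
      by_cases h : i = j
      · subst h; simpa using (hz i).trans ht.le
      · simpa [h] using hz i
    · intro i; exact mul_nonneg ha (hz i)
    · intro i; exact mul_le_mul_of_nonneg_right hab.le (hz i)
    · intro h
      apply hz0
      have : (b - a) • z = 0 := by rw [sub_smul, h, sub_self]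
      exact (smul_eq_zero.1 this).resolve_left (sub_pos.2 hab).ne'
  have hcont : ContinuousOn (fun t : ℝ => φ (t • z)) (Ici 0) :=
    hφ.continuousOn.comp (by fun_prop) (fun t ht i => mul_nonneg ht (hz i))
  obtain ⟨T, hT1, hT0⟩ := (((hφ.tendsto_atTop z hz hz0).eventually_ge_atTop 1).and
    (eventually_ge_atTop 0)).exists
  have h0 : (1 : ℝ) ∈ Icc (φ ((0 : ℝ) • z)) (φ (T • z)) := by
    rw [zero_smul, hφ.map_zero]; exact ⟨zero_le_one, hT1⟩
  obtain ⟨t, ht, ht1⟩ := intermediate_value_Icc hT0 (hcont.mono Icc_subset_Ici_self) h0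
  have htpos : 0 < t := by
    rcases ht.1.lt_or_eq with h | h
    · exact h
    · subst h; simp [hφ.map_zero] at ht1
  have hdiv : ∀ q : ℝ, (fun j => z j / q) = q⁻¹ • z := by
    intro q; ext j; simp [div_eq_inv_mul]
  refine ⟨t⁻¹, ⟨inv_pos.2 htpos, by rw [hdiv, inv_inv]; exact ht1⟩, ?_⟩
  rintro q ⟨hq, hq1⟩
  rw [hdiv] at hq1
  have : q⁻¹ = t := by
    rcases lt_trichotomy q⁻¹ t with h | h | h
    · have := hmono _ _ (inv_pos.2 hq).le h
      simp only at ht1; linarith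
    · exact h
    · have := hmono _ _ htpos.le h
      simp only at ht1; linarith
  rw [← this, inv_inv]

theorem existsUnique_orlicz_of_psi {m : ℕ} (hm : 0 < m) {φ : (Fin m → ℝ) → ℝ}
    (hφ : IsOrliczPsi φ) {z : Fin m → ℝ} (hz : z ∈ openOrthant m) :
    ∃! q : ℝ, 0 < q ∧ φ (fun j => z j / q) = 1 := by
  have hanti : ∀ a b : ℝ, 0 < a → a < b → φ (b • z) < φ (a • z) := by
    intro a b ha hab
    refine neg_lt_neg_iff.1 (lt_of_le_of_ne_of_update (S := openOrthant m)
      (f := fun z => -φ z) ?_ (fun z hz j t ht => neg_lt_neg (hφ.strictAnti z hz j t ht)) ?_ ?_ ?_)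
    · intro z hz j t ht i
      by_cases h : i = j
      · subst h; simpa using (hz i).trans ht
      · simpa [h] using hz i
    · intro i; exact mul_pos ha (hz i)
    · intro i; exact mul_le_mul_of_nonneg_right hab.le (hz i).le
    · intro h
      have := congrFun h ⟨0, hm⟩
      simp only [Pi.smul_apply, smul_eq_mul] at this
      exact hab.ne (mul_right_cancel₀ (hz _).ne' this)
  have hcont : ContinuousOn (fun t : ℝ => φ (t • z)) (Ioi 0) :=
    hφ.continuousOn.comp (by fun_prop) (fun t ht i => mul_pos ht (hz i))
  obtain ⟨b, hb1, hb0⟩ := (((hφ.tendsto_atTop z hz).eventually (gt_mem_nhds zero_lt_one)).and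
    (eventually_gt_atTop 0)).exists
  obtain ⟨a, ha1, ha0⟩ := (((hφ.tendsto_zero z hz).eventually_gt_atTop 1).and
    self_mem_nhdsWithin).exists
  obtain ⟨t, ht, ht1⟩ := isPreconnected_Ioi.intermediate_value (mem_Ioi.2 hb0) ha0 hcont
    (⟨hb1.le, ha1.le⟩ : (1 : ℝ) ∈ Icc _ _)
  have htpos : 0 < t := ht
  have hdiv : ∀ q : ℝ, (fun j => z j / q) = q⁻¹ • z := by
    intro q; ext j; simp [div_eq_inv_mul]
  refine ⟨t⁻¹, ⟨inv_pos.2 htpos, by rw [hdiv, inv_inv]; exact ht1⟩, ?_⟩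
  rintro q ⟨hq, hq1⟩
  rw [hdiv] at hq1
  have : q⁻¹ = t := by
    rcases lt_trichotomy q⁻¹ t with h | h | h
    · have := hanti _ _ (inv_pos.2 hq) h
      simp only at ht1; linarith
    · exact h
    · have := hanti _ _ htpos h
      simp only at ht1; linarith
  rw [← this, inv_inv]

theorem orliczSum_eq {m : ℕ} {X : Type*} {φ : (Fin m → ℝ) → ℝ} {p : Fin m → X → ℝ} {x : X}
    (h : ∃! q : ℝ, 0 < q ∧ φ (fun j => p j x / q) = 1) {q : ℝ} (hq : 0 < q)
    (hq1 : φ (fun j => p j x / q) = 1) : orliczSum φ p x = q := by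
  have he := h.exists
  rw [orliczSum, dif_pos he]
  exact h.unique he.choose_spec ⟨hq, hq1⟩

/-- Positivity of the support function of a body with the origin in its interior. -/
theorem supportFun_pos {n : ℕ} {L : ConvexBody (EuclideanSpace ℝ (Fin n))}
    (hL : (0 : EuclideanSpace ℝ (Fin n)) ∈ interior (L : Set (EuclideanSpace ℝ (Fin n))))
    (u : Metric.sphere (0 : EuclideanSpace ℝ (Fin n)) 1) : 0 < supportFun L u := by
  obtain ⟨r, hr, hb⟩ := Metric.mem_nhds_iff.1 (mem_interior_iff_mem_nhds.1 hL)
  have hun : ‖(u : EuclideanSpace ℝ (Fin n))‖ = 1 := by simp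
  have hmem : (r / 2) • (u : EuclideanSpace ℝ (Fin n)) ∈ (L : Set _) := by
    apply hb
    rw [mem_ball_zero_iff, norm_smul, hun, Real.norm_of_nonneg (by positivity)]
    linarith
  have hbdd : BddAbove ((fun x => ⟪x, (u : EuclideanSpace ℝ (Fin n))⟫) ''
      (L : Set (EuclideanSpace ℝ (Fin n)))) :=
    (L.isCompact.image (by fun_prop)).bddAbove
  refine lt_of_lt_of_le ?_ (le_csSup hbdd (mem_image_of_mem _ hmem))
  simp only [real_inner_smul_left, real_inner_self_eq_norm_sq, hun]
  positivity

/-- If the Orlicz sum of convex bodies is a convex body `M`, that is, if `h_M` solves the equation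
`φ (h_{L₁} / h_M, …, h_{L_m} / h_M) = 1`, then `mixedVolumeOrlicz` is `V_s (K, M)`. -/
theorem mixedVolumeOrlicz_eq {n m : ℕ} (hm : 0 < m) (s : ℝ)
    (K M : ConvexBody (EuclideanSpace ℝ (Fin n)))
    (L : Fin m → ConvexBody (EuclideanSpace ℝ (Fin n))) {φ : (Fin m → ℝ) → ℝ}
    (hφ : IsOrliczPhi φ ∨ IsOrliczPsi φ)
    (hL : ∀ j, (0 : EuclideanSpace ℝ (Fin n)) ∈
      interior (L j : Set (EuclideanSpace ℝ (Fin n))))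
    (hM : (0 : EuclideanSpace ℝ (Fin n)) ∈ interior (M : Set (EuclideanSpace ℝ (Fin n))))
    (h : ∀ u, φ (fun j => supportFun (L j) u / supportFun M u) = 1) :
    mixedVolumeOrlicz s K φ L = mixedVolume s K M := by
  have : orliczSum φ (fun j => supportFun (L j)) = supportFun M := by
    funext u
    have hpos : (fun j => supportFun (L j) u) ∈ openOrthant m := fun j => supportFun_pos (hL j) u
    refine orliczSum_eq ?_ (supportFun_pos hM u) (h u)
    rcases hφ with hφ | hφ
    · refine existsUnique_orlicz_of_phi hφ (fun j => (hpos j).le) fun h0 => ?_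
      exact (hpos ⟨0, hm⟩).ne' (congrFun h0 ⟨0, hm⟩)
    · exact existsUnique_orlicz_of_psi hm hφ hpos
  rw [mixedVolumeOrlicz, mixedVolume, this]

/-! Let `h` be the Orlicz sum and weight `S_K` by `h^s h_K^{1-s}`. Against the resulting measure
`ν`, the quotients of mixed volumes are the averages of `(h_{K_j}/h)^s`
(`exists_measure_average_eq_mixedVolumeFun_div`). By definition of `h`, `φ_s` equals 1 at every
vector `((h_{K_j}/h)^s)_j`, so both inequalities are Jensen's. In the strict cases, equality means
that this vector is `ν`-a.e. constant, which amounts to proportionality of the `h_{K_j}` on the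
support of `S_K` (`exists_ae_eq_const_iff_proportional`).

Jensen needs `h` continuous and `S_K` finite and nonzero. Continuity of `h` follows from
monotonicity of `φ` along rays. For finiteness, regular boundary points are pushed outward along
their normals onto the boundary of a cube, a map that does not decrease distances. For nonvanishing,
part of the boundary is the graph of a concave function; by Rademacher's theorem almost all its
points are regular, and projecting the graph to its base does not increase Hausdorff measure. -/

/-! ### Coordinate slices of Euclidean space -/

/-- The point of `ℝ^{k+1}` with `i`-th coordinate `t` and remaining coordinates `y`. -/
def insertCoord {k : ℕ} (i : Fin (k + 1)) (t : ℝ) (y : EuclideanSpace ℝ (Fin k)) :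
    EuclideanSpace ℝ (Fin (k + 1)) :=
  WithLp.toLp 2 (i.insertNth t y.ofLp)

/-- Forget the `i`-th coordinate. -/
def dropCoord {k : ℕ} (i : Fin (k + 1)) (x : EuclideanSpace ℝ (Fin (k + 1))) :
    EuclideanSpace ℝ (Fin k) :=
  WithLp.toLp 2 (i.removeNth x.ofLp)

section Coord

variable {k : ℕ} (i : Fin (k + 1))

@[simp] theorem dropCoord_insertCoord (t : ℝ) (y : EuclideanSpace ℝ (Fin k)) :
    dropCoord i (insertCoord i t y) = y := by
  simp [dropCoord, insertCoord]

@[simp] theorem insertCoord_apply_self (t : ℝ) (y : EuclideanSpace ℝ (Fin k)) :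
    insertCoord i t y i = t := by
  simp [insertCoord]

@[simp] theorem insertCoord_dropCoord (x : EuclideanSpace ℝ (Fin (k + 1))) :
    insertCoord i (x i) (dropCoord i x) = x := by
  simp [dropCoord, insertCoord]

theorem inner_insertCoord (t : ℝ) (y : EuclideanSpace ℝ (Fin k))
    (x : EuclideanSpace ℝ (Fin (k + 1))) :
    ⟪insertCoord i t y, x⟫ = t * x i + ⟪y, dropCoord i x⟫ := by
  simp [insertCoord, dropCoord, PiLp.inner_apply, Fin.sum_univ_succAbove _ i, Fin.removeNth,
    mul_comm]

theorem norm_sq_insertCoord (t : ℝ) (y : EuclideanSpace ℝ (Fin k)) :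
    ‖insertCoord i t y‖ ^ 2 = t ^ 2 + ‖y‖ ^ 2 := by
  rw [← real_inner_self_eq_norm_sq, inner_insertCoord, insertCoord_apply_self,
    dropCoord_insertCoord, real_inner_self_eq_norm_sq, sq t]

theorem insertCoord_combo (a b t t' : ℝ) (y y' : EuclideanSpace ℝ (Fin k)) :
    insertCoord i (a * t + b * t') (a • y + b • y') =
      a • insertCoord i t y + b • insertCoord i t' y' := by
  ext j
  refine Fin.succAboveCases i ?_ (fun j => ?_) j <;> simp [insertCoord]

theorem insertCoord_sub (t t' : ℝ) (y y' : EuclideanSpace ℝ (Fin k)) :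
    insertCoord i t y - insertCoord i t' y' = insertCoord i (t - t') (y - y') := by
  ext j
  refine Fin.succAboveCases i ?_ (fun j => ?_) j <;> simp [insertCoord]

theorem lipschitzWith_insertCoord (t : ℝ) :
    LipschitzWith 1 (insertCoord i t : EuclideanSpace ℝ (Fin k) → _) := by
  refine LipschitzWith.of_dist_le_mul fun y y' => ?_
  rw [NNReal.coe_one, one_mul, dist_eq_norm, dist_eq_norm, insertCoord_sub]
  refine le_of_sq_le_sq ?_ (norm_nonneg _)
  rw [norm_sq_insertCoord]
  simp

theorem lipschitzWith_dropCoord :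
    LipschitzWith 1 (dropCoord i : EuclideanSpace ℝ (Fin (k + 1)) → _) := by
  refine LipschitzWith.of_dist_le_mul fun x x' => ?_
  rw [NNReal.coe_one, one_mul, dist_eq_norm, dist_eq_norm]
  refine le_of_sq_le_sq ?_ (norm_nonneg _)
  conv_rhs => rw [← insertCoord_dropCoord i x, ← insertCoord_dropCoord i x', insertCoord_sub,
    norm_sq_insertCoord]
  exact le_add_of_nonneg_left (sq_nonneg _)

theorem abs_apply_le_norm_euclidean (x : EuclideanSpace ℝ (Fin (k + 1))) : |x i| ≤ ‖x‖ := by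
  simpa using PiLp.norm_apply_le x i

end Coord

/-! ### Hausdorff measure under Lipschitz and antilipschitz maps -/

section Hausdorff

variable {X Y : Type*} [EMetricSpace X] [MeasurableSpace X] [BorelSpace X]
  [EMetricSpace Y] [MeasurableSpace Y] [BorelSpace Y]

theorem LipschitzWith.euclideanHausdorffMeasure_image_le {f : X → Y} (hf : LipschitzWith 1 f)
    (d : ℕ) (s : Set X) : μHE[d] (f '' s) ≤ μHE[d] s := by
  simp_rw [Measure.euclideanHausdorffMeasure_def, Measure.smul_apply]
  gcongr
  simpa using hf.hausdorffMeasure_image_le (d := d) (by positivity) s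

theorem AntilipschitzWith.le_euclideanHausdorffMeasure_image {f : X → Y}
    (hf : AntilipschitzWith 1 f) (d : ℕ) (s : Set X) : μHE[d] s ≤ μHE[d] (f '' s) := by
  simp_rw [Measure.euclideanHausdorffMeasure_def, Measure.smul_apply]
  gcongr
  simpa using hf.le_hausdorffMeasure_image (d := d) (by positivity) s

end Hausdorff

/-- The boundary of a cube has finite `(n-1)`-dimensional Hausdorff measure. -/
theorem euclideanHausdorffMeasure_cube_boundary_lt_top {k : ℕ} (R : ℝ) :
    μHE[k] {x : EuclideanSpace ℝ (Fin (k + 1)) | ‖x.ofLp‖ = R} < ⊤ := by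
  set B : Set (EuclideanSpace ℝ (Fin k)) := WithLp.toLp 2 '' Metric.closedBall 0 R with hB
  have hBc : IsCompact B := (isCompact_closedBall 0 R).image (PiLp.continuous_toLp 2 _)
  have hBfin : μHE[k] B < ⊤ := by
    rw [EuclideanSpace.euclideanHausdorffMeasure_eq_volume]
    exact hBc.measure_lt_top
  -- The sup norm is attained at some coordinate, so the boundary is covered by `2(k+1)` faces, each
  -- a 1-Lipschitz image of a `k`-dimensional cube.
  have hsub : {x : EuclideanSpace ℝ (Fin (k + 1)) | ‖x.ofLp‖ = R} ⊆
      ⋃ i : Fin (k + 1), ⋃ b : Bool, insertCoord i (cond b R (-R)) '' B := by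
    intro x hx
    have hx' : ‖x.ofLp‖ = R := hx
    obtain ⟨i, hi⟩ : ∃ i, ‖x.ofLp i‖ = R := by
      obtain ⟨i, -, hi⟩ := Finset.exists_mem_eq_sup Finset.univ Finset.univ_nonempty
        (fun i => ‖x.ofLp i‖₊)
      exact ⟨i, by rw [← hx', Pi.norm_def, hi]; rfl⟩
    refine mem_iUnion.2 ⟨i, mem_iUnion.2 ?_⟩
    have hmem : dropCoord i x ∈ B := by
      refine ⟨_, ?_, rfl⟩
      rw [mem_closedBall_zero_iff, pi_norm_le_iff_of_nonneg (hx' ▸ norm_nonneg _)]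
      intro j
      exact (norm_le_pi_norm x.ofLp _).trans hx'.le
    rw [Real.norm_eq_abs] at hi
    rcases eq_or_eq_neg_of_abs_eq hi with h | h
    · exact ⟨true, _, hmem, by rw [cond_true, ← h]; exact insertCoord_dropCoord i x⟩
    · exact ⟨false, _, hmem, by rw [cond_false, ← h]; exact insertCoord_dropCoord i x⟩
  refine (measure_mono hsub).trans_lt ((measure_iUnion_fintype_le _ _).trans_lt ?_)
  refine ENNReal.sum_lt_top.2 fun i _ => (measure_iUnion_fintype_le _ _).trans_lt ?_
  refine ENNReal.sum_lt_top.2 fun b _ => ?_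
  exact ((lipschitzWith_insertCoord i _).euclideanHausdorffMeasure_image_le k B).trans_lt hBfin

/-! ### Finiteness of the surface area measure -/

theorem surfaceAreaMeasure_univ {n : ℕ} (K : ConvexBody (EuclideanSpace ℝ (Fin n))) :
    surfaceAreaMeasure K univ = μHE[n - 1] (univ : Set (regularBoundary K)) := by
  rw [surfaceAreaMeasure, Measure.map_apply (continuous_gaussMap K).measurable MeasurableSet.univ,
    preimage_univ]

/-- By the two normal conditions, the displacements along the normals contribute nonnegatively to
the inner product of `x - y` with the difference of the images, which is thus at least `‖x - y‖²`;
Cauchy–Schwarz concludes. No regularity of `t` is needed. -/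
theorem antilipschitzWith_add_smul_gaussMap {n : ℕ} (K : ConvexBody (EuclideanSpace ℝ (Fin n)))
    {t : regularBoundary K → ℝ} (ht : ∀ x, 0 ≤ t x) :
    AntilipschitzWith 1 fun x : regularBoundary K =>
      (x : EuclideanSpace ℝ (Fin n)) + t x • (gaussMap K x : EuclideanSpace ℝ (Fin n)) := by
  refine AntilipschitzWith.of_le_mul_dist fun x y => ?_
  have hK : ∀ x : regularBoundary K, (x : EuclideanSpace ℝ (Fin n)) ∈ K := fun x =>
    K.isClosed.frontier_subset x.2.1
  have h1 := (gaussMap_spec K x _).2 rfl y (hK y)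
  have h2 := (gaussMap_spec K y _).2 rfl x (hK x)
  rw [NNReal.coe_one, one_mul, Subtype.dist_eq, dist_eq_norm, dist_eq_norm]
  set u : EuclideanSpace ℝ (Fin n) := (gaussMap K x).1
  set v : EuclideanSpace ℝ (Fin n) := (gaussMap K y).1
  set a : EuclideanSpace ℝ (Fin n) := x.1
  set b : EuclideanSpace ℝ (Fin n) := y.1
  have h3 : ‖a - b‖ ^ 2 ≤ ⟪a - b, a + t x • u - (b + t y • v)⟫ := by
    have : ⟪a - b, a + t x • u - (b + t y • v)⟫ =
        ‖a - b‖ ^ 2 + t x * (⟪a, u⟫ - ⟪b, u⟫) + t y * (⟪b, v⟫ - ⟪a, v⟫) := by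
      rw [add_sub_add_comm, inner_add_right, real_inner_self_eq_norm_sq, inner_sub_right,
        real_inner_smul_right, real_inner_smul_right, inner_sub_left, inner_sub_left]
      ring
    rw [this, add_assoc]
    exact le_add_of_nonneg_right (add_nonneg (mul_nonneg (ht x) (sub_nonneg.2 h1))
      (mul_nonneg (ht y) (sub_nonneg.2 h2)))
  have h4 := h3.trans (real_inner_le_norm _ _)
  rcases (norm_nonneg (a - b)).eq_or_lt with h | h
  · rw [← h]; exact norm_nonneg _
  · rw [sq] at h4
    exact le_of_mul_le_mul_left h4 h

theorem exists_norm_ofLp_add_smul_eq {n : ℕ} {R : ℝ} {x u : EuclideanSpace ℝ (Fin n)}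
    (hx : ‖x.ofLp‖ ≤ R) (hu : u ≠ 0) : ∃ t : ℝ, 0 ≤ t ∧ ‖(x + t • u).ofLp‖ = R := by
  have hcont : Continuous fun t : ℝ => ‖(x + t • u).ofLp‖ := by fun_prop
  have hu' : 0 < ‖u.ofLp‖ := by
    rw [norm_pos_iff]; exact fun h => hu (by ext i; simp [h])
  have hR : 0 ≤ R := (norm_nonneg _).trans hx
  -- At this time the displacement has sup norm `2R`, so the endpoint has sup norm at least `2R -
  -- R`.
  have hT : 0 ≤ 2 * R / ‖u.ofLp‖ := by positivity
  have h2 : R ≤ ‖(x + (2 * R / ‖u.ofLp‖) • u).ofLp‖ := by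
    have h3 : ‖((2 * R / ‖u.ofLp‖) • u).ofLp‖ = 2 * R := by
      rw [WithLp.ofLp_smul, norm_smul, Real.norm_of_nonneg hT, div_mul_cancel₀ _ hu'.ne']
    have h4 := norm_sub_le (x + (2 * R / ‖u.ofLp‖) • u).ofLp x.ofLp
    rw [← WithLp.ofLp_sub, add_sub_cancel_left, h3] at h4
    linarith
  obtain ⟨t, ht, hteq⟩ := intermediate_value_Icc hT hcont.continuousOn
    (⟨by simpa using hx, h2⟩ : R ∈ Icc _ _)
  exact ⟨t, ht.1, hteq⟩

/-- Enclose `K` in a cube and move each regular point along its normal until it meets the cube's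
boundary. This map is antilipschitz with constant 1, so the regular boundary has no more Hausdorff
measure than the cube's boundary. -/
theorem isFiniteMeasure_surfaceAreaMeasure {n : ℕ} (hn : 1 ≤ n)
    (K : ConvexBody (EuclideanSpace ℝ (Fin n))) : IsFiniteMeasure (surfaceAreaMeasure K) := by
  obtain ⟨k, rfl⟩ := Nat.exists_eq_add_of_le' hn
  refine ⟨?_⟩
  rw [surfaceAreaMeasure_univ, Nat.add_sub_cancel]
  obtain ⟨R, hR⟩ := (K.isCompact.image (PiLp.continuous_ofLp 2 (fun _ : Fin (k + 1) => ℝ))).isBounded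
    |>.exists_norm_le
  have hex : ∀ x : regularBoundary K, ∃ t : ℝ, 0 ≤ t ∧
      ‖((x : EuclideanSpace ℝ (Fin (k + 1))) +
        t • (gaussMap K x : EuclideanSpace ℝ (Fin (k + 1)))).ofLp‖ = R := by
    intro x
    exact exists_norm_ofLp_add_smul_eq
      (hR _ (mem_image_of_mem _ (K.isClosed.frontier_subset x.2.1)))
      (ne_zero_of_mem_unit_sphere _)
  choose t ht0 htR using hex
  refine ((antilipschitzWith_add_smul_gaussMap K ht0).le_euclideanHausdorffMeasure_image k
    univ).trans_lt ((measure_mono ?_).trans_lt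
      (euclideanHausdorffMeasure_cube_boundary_lt_top (k := k) R))
  rintro _ ⟨x, -, rfl⟩
  exact htR x

/-! ### Positivity of the surface area measure -/

/-- Hahn–Banach separates `x` from the interior. Nonemptiness of the interior makes the functional
nonzero and carries the inequality to all of `K`, the closure of its interior. -/
theorem exists_isOuterNormal {n : ℕ} {K : ConvexBody (EuclideanSpace ℝ (Fin n))}
    (hK : (interior (K : Set (EuclideanSpace ℝ (Fin n)))).Nonempty)
    {x : EuclideanSpace ℝ (Fin n)} (hx : x ∈ frontier (K : Set (EuclideanSpace ℝ (Fin n)))) :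
    ∃ u, IsOuterNormal K x u := by
  obtain ⟨f, hf⟩ := geometric_hahn_banach_open_point K.convex.interior isOpen_interior hx.2
  obtain ⟨p, hp⟩ := hK
  set v := (InnerProductSpace.toDual ℝ (EuclideanSpace ℝ (Fin n))).symm f
  have hv : ∀ y, ⟪y, v⟫ = f y := fun y => by
    rw [real_inner_comm, InnerProductSpace.toDual_symm_apply]
  have hv0 : v ≠ 0 := by
    intro h
    have := hf p hp
    simp [← hv, h] at this
  have hle : ∀ y ∈ K, f y ≤ f x := by
    intro y hy
    have hy' : y ∈ closure (interior (K : Set (EuclideanSpace ℝ (Fin n)))) := by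
      rw [K.convex.closure_interior_eq_closure_of_nonempty_interior ⟨p, hp⟩]
      exact subset_closure hy
    exact closure_minimal (fun z hz => (hf z hz).le)
      (isClosed_le f.continuous continuous_const) hy'
  refine ⟨⟨‖v‖⁻¹ • v, by simp [norm_smul, hv0]⟩, fun y hy => ?_⟩
  simp only [real_inner_smul_right, hv]
  gcongr
  exact hle y hy

/-- The height over `y` of the upper boundary of a convex body. -/
noncomputable def upperHeight {k : ℕ} (K : ConvexBody (EuclideanSpace ℝ (Fin (k + 1))))
    (y : EuclideanSpace ℝ (Fin k)) : ℝ :=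
  sSup {t | insertCoord 0 t y ∈ K}

section UpperHeight

variable {k : ℕ} {K : ConvexBody (EuclideanSpace ℝ (Fin (k + 1)))}

theorem bddAbove_insertCoord_mem (y : EuclideanSpace ℝ (Fin k)) :
    BddAbove {t | insertCoord 0 t y ∈ K} := by
  obtain ⟨R, hR⟩ := K.isCompact.isBounded.exists_norm_le
  refine ⟨R, fun t ht => ?_⟩
  have := abs_apply_le_norm_euclidean 0 (insertCoord 0 t y)
  rw [insertCoord_apply_self] at this
  exact (le_abs_self t).trans (this.trans (hR _ ht))

theorem le_upperHeight {t : ℝ} {y : EuclideanSpace ℝ (Fin k)} (h : insertCoord 0 t y ∈ K) :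
    t ≤ upperHeight K y :=
  le_csSup (bddAbove_insertCoord_mem y) h

theorem continuous_insertCoord (y : EuclideanSpace ℝ (Fin k)) :
    Continuous fun t : ℝ => insertCoord 0 t y := by
  refine (PiLp.continuous_toLp 2 _).comp (continuous_pi fun j => ?_)
  refine Fin.cases ?_ (fun j => ?_) j
  · simpa using continuous_id'
  · simpa using continuous_const

theorem insertCoord_upperHeight_mem {t : ℝ} {y : EuclideanSpace ℝ (Fin k)}
    (h : insertCoord 0 t y ∈ K) : insertCoord 0 (upperHeight K y) y ∈ K := by
  have hcl : IsClosed {t | insertCoord 0 t y ∈ K} :=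
    K.isClosed.preimage (continuous_insertCoord y)
  exact hcl.csSup_mem ⟨t, h⟩ (bddAbove_insertCoord_mem y)

theorem insertCoord_upperHeight_mem_frontier {t : ℝ} {y : EuclideanSpace ℝ (Fin k)}
    (h : insertCoord 0 t y ∈ K) :
    insertCoord 0 (upperHeight K y) y ∈
      frontier (K : Set (EuclideanSpace ℝ (Fin (k + 1)))) := by
  refine ⟨subset_closure (insertCoord_upperHeight_mem h), fun hint => ?_⟩
  have h1 : ∀ᶠ s in 𝓝 (upperHeight K y), insertCoord 0 s y ∈ K :=
    (continuous_insertCoord y).continuousAt.eventually (mem_interior_iff_mem_nhds.1 hint)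
  obtain ⟨s, hsK, hs⟩ := ((h1.filter_mono nhdsWithin_le_nhds).and
    (self_mem_nhdsWithin (s := Ioi (upperHeight K y)))).exists
  exact (le_upperHeight hsK).not_gt hs

theorem concaveOn_upperHeight {B : Set (EuclideanSpace ℝ (Fin k))} (hB : Convex ℝ B)
    (h : ∀ y ∈ B, ∃ t, insertCoord 0 t y ∈ K) : ConcaveOn ℝ B (upperHeight K) := by
  refine ⟨hB, fun y hy z hz a b ha hb hab => le_upperHeight ?_⟩
  obtain ⟨t, ht⟩ := h y hy
  obtain ⟨t', ht'⟩ := h z hz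
  rw [smul_eq_mul, smul_eq_mul, insertCoord_combo]
  exact K.convex (insertCoord_upperHeight_mem ht) (insertCoord_upperHeight_mem ht') ha hb hab

/-- At a point of differentiability of the height function, the outer normal is unique. -/
theorem insertCoord_upperHeight_mem_regularBoundary
    (hK : (interior (K : Set (EuclideanSpace ℝ (Fin (k + 1))))).Nonempty)
    {y : EuclideanSpace ℝ (Fin k)} {t : ℝ} (hty : t < upperHeight K y)
    (ht : ∀ᶠ z in 𝓝 y, insertCoord 0 t z ∈ K)
    (hd : DifferentiableAt ℝ (upperHeight K) y) :
    insertCoord 0 (upperHeight K y) y ∈ regularBoundary K := by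
  have hfr := insertCoord_upperHeight_mem_frontier ht.self_of_nhds
  refine ⟨hfr, ?_⟩
  set w := (InnerProductSpace.toDual ℝ (EuclideanSpace ℝ (Fin k))).symm
    (fderiv ℝ (upperHeight K) y)
  have hw : ∀ z, ⟪w, z⟫ = fderiv ℝ (upperHeight K) y z := fun z =>
    InnerProductSpace.toDual_symm_apply
  -- Every outer normal is a nonnegative multiple of `(1, -∇)`, with `∇` the gradient of the height
  -- function at `y`; unit length then leaves only one.
  have key : ∀ u, IsOuterNormal K (insertCoord 0 (upperHeight K y) y) u →
      0 ≤ (u : EuclideanSpace ℝ (Fin (k + 1))) 0 ∧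
      (u : EuclideanSpace ℝ (Fin (k + 1))) =
        (u : EuclideanSpace ℝ (Fin (k + 1))) 0 • insertCoord 0 1 (-w) := by
    intro u hu
    set c := (u : EuclideanSpace ℝ (Fin (k + 1))) 0 with hc
    set q := dropCoord 0 (u : EuclideanSpace ℝ (Fin (k + 1))) with hq
    have hle : ∀ s z, insertCoord 0 s z ∈ K →
        s * c + ⟪z, q⟫ ≤ upperHeight K y * c + ⟪y, q⟫ := by
      intro s z hs
      have := hu _ hs
      rwa [inner_insertCoord, inner_insertCoord] at this
    -- The point at height `t` over `y` lies in `K` strictly below the top point, so the normal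
    -- cannot point downward.
    have hc0 : 0 ≤ c := by
      have := hle t y ht.self_of_nhds
      by_contra hneg
      nlinarith [mul_pos (sub_pos.2 hty) (neg_pos.2 (not_le.1 hneg))]
    refine ⟨hc0, ?_⟩
    -- The linear functional `⟪·, u⟫`, restricted to the graph, is maximal over `y`; its derivative
    -- vanishes there.
    have hmax : IsLocalMax (fun z => upperHeight K z * c + ⟪q, z⟫) y := by
      filter_upwards [ht] with z hz
      have := hle _ z (insertCoord_upperHeight_mem hz)
      rwa [real_inner_comm, real_inner_comm q] at this
    have hder : HasFDerivAt (fun z => upperHeight K z * c + ⟪q, z⟫)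
        (c • fderiv ℝ (upperHeight K) y + innerSL ℝ q) y :=
      (hd.hasFDerivAt.mul_const c).add (innerSL ℝ q).hasFDerivAt
    have hz := hmax.hasFDerivAt_eq_zero hder
    have hqw : q = c • (-w) := by
      refine ext_inner_right ℝ fun z => ?_
      have := DFunLike.congr_fun hz z
      simp only [add_apply, smul_apply,
        innerSL_apply_apply, zero_apply, smul_eq_mul, ← hw] at this
      rw [real_inner_smul_left, inner_neg_left]
      linarith
    rw [← insertCoord_dropCoord 0 (u : EuclideanSpace ℝ (Fin (k + 1))), ← hc, ← hq, hqw]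
    have := insertCoord_combo 0 c 0 1 0 (-w) 0
    simpa using this
  obtain ⟨u, hu⟩ := exists_isOuterNormal hK hfr
  refine ⟨u, hu, fun v hv => ?_⟩
  obtain ⟨hu0, hu1⟩ := key u hu
  obtain ⟨hv0, hv1⟩ := key v hv
  have hp : ‖insertCoord 0 1 (-w)‖ ≠ 0 := by
    intro h
    rw [norm_eq_zero.1 h, smul_zero] at hu1
    exact ne_zero_of_mem_unit_sphere u hu1
  have hnu := congrArg norm hu1
  have hnv := congrArg norm hv1
  rw [norm_smul, Real.norm_of_nonneg hu0, norm_eq_of_mem_sphere] at hnu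
  rw [norm_smul, Real.norm_of_nonneg hv0, norm_eq_of_mem_sphere] at hnv
  apply Subtype.ext
  rw [hu1, hv1, mul_right_cancel₀ hp (hnv.symm.trans hnu)]

end UpperHeight

/-- The regular points on the upper graph project 1-Lipschitzly onto almost all of a small ball in
`ℝ^k`, whose Lebesgue measure is positive and bounds theirs from below. -/
theorem surfaceAreaMeasure_ne_zero {n : ℕ} (hn : 1 ≤ n)
    {K : ConvexBody (EuclideanSpace ℝ (Fin n))}
    (hK : (0 : EuclideanSpace ℝ (Fin n)) ∈ interior (K : Set (EuclideanSpace ℝ (Fin n)))) :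
    surfaceAreaMeasure K ≠ 0 := by
  obtain ⟨k, rfl⟩ := Nat.exists_eq_add_of_le' hn
  rw [← Measure.measure_univ_ne_zero, surfaceAreaMeasure_univ, Nat.add_sub_cancel]
  obtain ⟨r, hr, hb⟩ := Metric.mem_nhds_iff.1 (mem_interior_iff_mem_nhds.1 hK)
  have hmem : ∀ t : ℝ, |t| ≤ r / 2 → ∀ y ∈ Metric.ball (0 : EuclideanSpace ℝ (Fin k)) (r / 2),
      insertCoord 0 t y ∈ K := by
    intro t ht y hy
    refine hb ?_
    rw [mem_ball_zero_iff] at hy ⊢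
    refine lt_of_pow_lt_pow_left₀ 2 hr.le ?_
    rw [norm_sq_insertCoord, ← sq_abs t]
    nlinarith [norm_nonneg y, abs_nonneg t]
  have hr2 : 0 < r / 2 := by positivity
  have hconc : ConcaveOn ℝ (Metric.ball (0 : EuclideanSpace ℝ (Fin k)) (r / 2))
      (upperHeight K) := by
    refine concaveOn_upperHeight (convex_ball _ _) fun y hy => ⟨0, hmem 0 ?_ y hy⟩
    simpa using hr2.le
  obtain ⟨C, s, hs, hlip⟩ := hconc.locallyLipschitzOn Metric.isOpen_ball
    (Metric.mem_ball_self hr2)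
  rw [nhdsWithin_eq_nhds.2 (Metric.ball_mem_nhds _ hr2)] at hs
  obtain ⟨ρ, hρ, hρs⟩ := Metric.mem_nhds_iff.1 (inter_mem hs (Metric.ball_mem_nhds _ hr2))
  set B := Metric.ball (0 : EuclideanSpace ℝ (Fin k)) ρ
  -- Rademacher's theorem, on a ball where the concave height function is Lipschitz.
  have hae : ∀ᵐ y : EuclideanSpace ℝ (Fin k), y ∈ B →
      DifferentiableWithinAt ℝ (upperHeight K) B y :=
    (hlip.mono fun y hy => (hρs hy).1).ae_differentiableWithinAt_of_mem
  have hsub : (B \ {y | y ∈ B → DifferentiableWithinAt ℝ (upperHeight K) B y}ᶜ) ⊆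
      (fun x : regularBoundary K => dropCoord 0 (x : EuclideanSpace ℝ (Fin (k + 1)))) ''
        univ := by
    rintro y ⟨hy, hyd⟩
    have hyr := (hρs hy).2
    have hd : DifferentiableAt ℝ (upperHeight K) y :=
      (not_not.1 hyd hy).differentiableAt (Metric.isOpen_ball.mem_nhds hy)
    refine ⟨⟨_, insertCoord_upperHeight_mem_regularBoundary ⟨0, hK⟩ (t := 0) ?_ ?_ hd⟩,
      mem_univ _, by simp⟩
    · exact hr2.trans_le (le_upperHeight (hmem _ (abs_of_pos hr2).le y hyr))
    · filter_upwards [Metric.isOpen_ball.mem_nhds hyr] with z hz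
      exact hmem 0 (by simpa using hr2.le) z hz
  have hlipdrop : LipschitzWith 1
      (fun x : regularBoundary K => dropCoord 0 (x : EuclideanSpace ℝ (Fin (k + 1)))) := by
    simpa [Function.comp_def] using
      (lipschitzWith_dropCoord 0).comp (LipschitzWith.subtype_val (regularBoundary K))
  have hle := (measure_mono hsub).trans (hlipdrop.euclideanHausdorffMeasure_image_le k univ)
  rw [EuclideanSpace.euclideanHausdorffMeasure_eq_volume, measure_sdiff_null hae] at hle
  exact ((Metric.measure_ball_pos volume _ hρ).trans_le hle).ne'

/-! ### Continuity of Orlicz sums -/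

theorem smul_lt_smul_orthant {m : ℕ} (hm : 0 < m) {z : Fin m → ℝ} (hz : z ∈ openOrthant m)
    {a b : ℝ} (hab : a < b) : a • z ≤ b • z ∧ a • z ≠ b • z := by
  refine ⟨fun i => mul_le_mul_of_nonneg_right hab.le (hz i).le, fun h => ?_⟩
  have := congrFun h ⟨0, hm⟩
  simp only [Pi.smul_apply, smul_eq_mul] at this
  exact hab.ne (mul_right_cancel₀ (hz _).ne' this)

theorem update_mem_openOrthant {m : ℕ} {z : Fin m → ℝ} (hz : z ∈ openOrthant m) (j : Fin m)
    {t : ℝ} (ht : z j < t) : Function.update z j t ∈ openOrthant m := by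
  intro i
  by_cases h : i = j
  · subst h; simpa using (hz i).trans ht
  · simpa [h] using hz i

theorem openOrthant_subset_closedOrthant (m : ℕ) : openOrthant m ⊆ closedOrthant m :=
  fun _ hz i => (hz i).le

theorem smul_mem_openOrthant {m : ℕ} {z : Fin m → ℝ} (hz : z ∈ openOrthant m) {a : ℝ}
    (ha : 0 < a) : a • z ∈ openOrthant m := fun i => mul_pos ha (hz i)

theorem IsOrliczPhi.strictMonoOn_smul {m : ℕ} (hm : 0 < m) {φ : (Fin m → ℝ) → ℝ}
    (hφ : IsOrliczPhi φ) {z : Fin m → ℝ} (hz : z ∈ openOrthant m) :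
    StrictMonoOn (fun t : ℝ => φ (t • z)) (Ioi 0) := fun _ ha _ _ hab =>
  lt_of_le_of_ne_of_update (fun _ hz j _ ht => update_mem_openOrthant hz j ht)
    (fun z hz => hφ.strictMono z (openOrthant_subset_closedOrthant m hz))
    (smul_mem_openOrthant hz ha) (smul_lt_smul_orthant hm hz hab).1
    (smul_lt_smul_orthant hm hz hab).2

/-- The sign lets `Ψ_m` share the increasing case, so continuity of the Orlicz sum is proved once
for both classes. -/
theorem IsOrliczPsi.strictMonoOn_neg_smul {m : ℕ} (hm : 0 < m) {φ : (Fin m → ℝ) → ℝ}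
    (hφ : IsOrliczPsi φ) {z : Fin m → ℝ} (hz : z ∈ openOrthant m) :
    StrictMonoOn (fun t : ℝ => -φ (t • z)) (Ioi 0) := fun _ ha _ _ hab =>
  lt_of_le_of_ne_of_update (f := fun z => -φ z)
    (fun _ hz j _ ht => update_mem_openOrthant hz j ht)
    (fun z hz j t ht => neg_lt_neg (hφ.strictAnti z hz j t ht))
    (smul_mem_openOrthant hz ha) (smul_lt_smul_orthant hm hz hab).1
    (smul_lt_smul_orthant hm hz hab).2

/-- The solution `h` of `f (p₁ / h, …, p_m / h) = c` depends continuously on the parameter. -/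
theorem continuous_of_strictMonoOn_smul {m : ℕ} {X : Type*} [TopologicalSpace X]
    {f : (Fin m → ℝ) → ℝ} (hf : ContinuousOn f (openOrthant m))
    (hmono : ∀ z ∈ openOrthant m, StrictMonoOn (fun t : ℝ => f (t • z)) (Ioi 0))
    {p : X → Fin m → ℝ} (hp : Continuous p) (hpos : ∀ x, p x ∈ openOrthant m)
    {h : X → ℝ} (hh : ∀ x, 0 < h x) {c : ℝ} (hc : ∀ x, f ((h x)⁻¹ • p x) = c) :
    Continuous h := by
  have hfa : ∀ a : ℝ, 0 < a → Continuous fun x => f (a⁻¹ • p x) := fun a ha =>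
    hf.comp_continuous (by fun_prop) fun x => smul_mem_openOrthant (hpos x) (inv_pos.2 ha)
  -- For fixed `a`, the right-hand side is an open condition on `x`; with `hgt` this gives both
  -- semicontinuities of `h`.
  have hlt : ∀ a : ℝ, 0 < a → ∀ x, a < h x ↔ c < f (a⁻¹ • p x) := by
    intro a ha x
    rw [← hc x, (hmono _ (hpos x)).lt_iff_lt (inv_pos.2 (hh x)) (inv_pos.2 ha),
      inv_lt_inv₀ (hh x) ha]
  have hgt : ∀ a : ℝ, 0 < a → ∀ x, h x < a ↔ f (a⁻¹ • p x) < c := by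
    intro a ha x
    rw [← hc x, (hmono _ (hpos x)).lt_iff_lt (inv_pos.2 ha) (inv_pos.2 (hh x)),
      inv_lt_inv₀ ha (hh x)]
  refine continuous_iff_continuousAt.2 fun x => tendsto_order.2 ⟨fun a ha => ?_, fun b hb => ?_⟩
  · rcases le_or_gt a 0 with ha0 | ha0
    · exact Eventually.of_forall fun y => ha0.trans_lt (hh y)
    · filter_upwards [(hfa a ha0).continuousAt.eventually (lt_mem_nhds ((hlt a ha0 x).1 ha))]
        with y hy using (hlt a ha0 y).2 hy
  · have hb0 := (hh x).trans hb
    filter_upwards [(hfa b hb0).continuousAt.eventually (gt_mem_nhds ((hgt b hb0 x).1 hb))]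
      with y hy using (hgt b hb0 y).2 hy

section OrliczSum

variable {m : ℕ} {X : Type*} {φ : (Fin m → ℝ) → ℝ} {p : Fin m → X → ℝ}

theorem existsUnique_orlicz (hm : 0 < m) (hφ : IsOrliczPhi φ ∨ IsOrliczPsi φ)
    {z : Fin m → ℝ} (hz : z ∈ openOrthant m) : ∃! q : ℝ, 0 < q ∧ φ (fun j => z j / q) = 1 := by
  rcases hφ with hφ | hφ
  · exact existsUnique_orlicz_of_phi hφ (openOrthant_subset_closedOrthant m hz)
      fun h => (hz ⟨0, hm⟩).ne' (congrFun h _)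
  · exact existsUnique_orlicz_of_psi hm hφ hz

theorem orliczSum_spec (hm : 0 < m) (hφ : IsOrliczPhi φ ∨ IsOrliczPsi φ) {x : X}
    (hp : ∀ j, 0 < p j x) :
    0 < orliczSum φ p x ∧ φ (fun j => p j x / orliczSum φ p x) = 1 := by
  have he := (existsUnique_orlicz hm hφ (z := fun j => p j x) hp).exists
  rw [orliczSum, dif_pos he]
  exact he.choose_spec

theorem continuousOn_openOrthant_of_orlicz (hφ : IsOrliczPhi φ ∨ IsOrliczPsi φ) :
    ContinuousOn φ (openOrthant m) :=
  hφ.elim (fun h => h.continuousOn.mono (openOrthant_subset_closedOrthant m))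
    fun h => h.continuousOn

theorem continuous_orliczSum [TopologicalSpace X] (hm : 0 < m)
    (hφ : IsOrliczPhi φ ∨ IsOrliczPsi φ) (hp : ∀ j x, 0 < p j x) (hc : ∀ j, Continuous (p j)) :
    Continuous (orliczSum φ p) := by
  have hpos : ∀ x, 0 < orliczSum φ p x := fun x => (orliczSum_spec hm hφ fun j => hp j x).1
  have heq : ∀ x, φ ((orliczSum φ p x)⁻¹ • fun j => p j x) = 1 := fun x => by
    rw [← (orliczSum_spec hm hφ fun j => hp j x).2]
    congr 1
    ext j
    simp [div_eq_inv_mul]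
  have hcφ := continuousOn_openOrthant_of_orlicz hφ
  rcases hφ with hφ | hφ
  · exact continuous_of_strictMonoOn_smul hcφ (fun z hz => hφ.strictMonoOn_smul hm hz)
      (continuous_pi hc) (fun x j => hp j x) hpos heq
  · exact continuous_of_strictMonoOn_smul (f := fun z => -φ z) hcφ.neg
      (fun z hz => hφ.strictMonoOn_neg_smul hm hz)
      (continuous_pi hc) (fun x j => hp j x) hpos (fun x => congrArg Neg.neg (heq x))

end OrliczSum

theorem continuousOn_orliczPow {m : ℕ} (s : ℝ) {φ : (Fin m → ℝ) → ℝ}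
    (hφ : ContinuousOn φ (openOrthant m)) : ContinuousOn (orliczPow s φ) (openOrthant m) := by
  refine hφ.comp (continuousOn_pi.2 fun j => ?_) fun z hz j => Real.rpow_pos_of_pos (hz j) _
  exact (continuous_apply j).continuousOn.rpow_const fun z hz => Or.inl (hz j).ne'

theorem continuous_supportFun {n : ℕ} (K : ConvexBody (EuclideanSpace ℝ (Fin n))) :
    Continuous (supportFun K) := by
  refine K.isCompact.continuous_sSup
    (f := fun (u : Metric.sphere (0 : EuclideanSpace ℝ (Fin n)) 1) x =>
      ⟪x, (u : EuclideanSpace ℝ (Fin n))⟫) ?_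
  simp only [Function.HasUncurry.uncurry, id]
  fun_prop

/-! ### Jensen's inequality for continuous maps into the open orthant -/

section Jensen

/-- Jensen's inequality is applied on a closed convex set, which the open orthant is not. By
compactness the values of `z` stay in a translated closed orthant inside it. -/
theorem exists_Ici_subset_openOrthant {m : ℕ} {X : Type*} [TopologicalSpace X]
    [CompactSpace X] {z : X → Fin m → ℝ} (hz : Continuous z)
    (hpos : ∀ x, z x ∈ openOrthant m) :
    ∃ c : Fin m → ℝ, Ici c ⊆ openOrthant m ∧ ∀ x, z x ∈ Ici c := by
  have : ∀ j, ∃ c : ℝ, 0 < c ∧ ∀ x, c ≤ z x j := by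
    intro j
    rcases isEmpty_or_nonempty X with h | h
    · exact ⟨1, one_pos, fun x => h.elim x⟩
    · obtain ⟨x, -, hx⟩ := isCompact_univ.exists_isMinOn univ_nonempty
        ((continuous_apply j).comp hz).continuousOn
      exact ⟨z x j, hpos x j, fun y => hx (mem_univ y)⟩
  choose c hc0 hc using this
  exact ⟨c, fun w hw j => (hc0 j).trans_le (hw j), fun x j => hc j x⟩

variable {m : ℕ} {X : Type*} [TopologicalSpace X] [CompactSpace X] [MeasurableSpace X]
  [BorelSpace X] {ν : Measure X} [IsFiniteMeasure ν]

theorem Continuous.integrable_of_compactSpace {E : Type*} [NormedAddCommGroup E]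
    [SecondCountableTopology E] {f : X → E} (hf : Continuous f) : Integrable f ν := by
  borelize E
  obtain ⟨C, hC⟩ := (isCompact_range hf).isBounded.exists_norm_le
  exact Integrable.of_bound hf.measurable.aestronglyMeasurable C
    (Eventually.of_forall fun x => hC _ (mem_range_self x))

variable [NeZero ν] {g : (Fin m → ℝ) → ℝ} {z : X → Fin m → ℝ} {c : ℝ}

theorem ConcaveOn.le_map_average_openOrthant (hg : ConcaveOn ℝ (openOrthant m) g)
    (hgc : ContinuousOn g (openOrthant m)) (hz : Continuous z)
    (hpos : ∀ x, z x ∈ openOrthant m) (hc : ∀ x, g (z x) = c) : c ≤ g (⨍ x, z x ∂ν) := by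
  obtain ⟨b, hb, hzb⟩ := exists_Ici_subset_openOrthant hz hpos
  have hcomp : g ∘ z = fun _ => c := funext hc
  have := (hg.subset hb (convex_Ici b)).le_map_average (hgc.mono hb) isClosed_Ici
    (Eventually.of_forall hzb) (hz.integrable_of_compactSpace (ν := ν))
    (hcomp ▸ integrable_const c)
  simpa [hc, average_const] using this

theorem ConvexOn.map_average_openOrthant_le (hg : ConvexOn ℝ (openOrthant m) g)
    (hgc : ContinuousOn g (openOrthant m)) (hz : Continuous z)
    (hpos : ∀ x, z x ∈ openOrthant m) (hc : ∀ x, g (z x) = c) : g (⨍ x, z x ∂ν) ≤ c :=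
  neg_le_neg_iff.1 (hg.neg.le_map_average_openOrthant hgc.neg hz hpos
    fun x => congrArg Neg.neg (hc x))

theorem StrictConcaveOn.map_average_openOrthant_eq_iff
    (hg : StrictConcaveOn ℝ (openOrthant m) g)
    (hgc : ContinuousOn g (openOrthant m)) (hz : Continuous z)
    (hpos : ∀ x, z x ∈ openOrthant m) (hc : ∀ x, g (z x) = c) :
    g (⨍ x, z x ∂ν) = c ↔ ∃ a, ∀ᵐ x ∂ν, z x = a := by
  constructor
  · intro h
    obtain ⟨b, hb, hzb⟩ := exists_Ici_subset_openOrthant hz hpos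
    have hcomp : g ∘ z = fun _ => c := funext hc
    have := (hg.subset hb (convex_Ici b)).ae_eq_const_or_lt_map_average (hgc.mono hb)
      isClosed_Ici (Eventually.of_forall hzb) (hz.integrable_of_compactSpace (ν := ν))
      (hcomp ▸ integrable_const c)
    simp only [hc, average_const, h, lt_irrefl, or_false] at this
    exact ⟨_, this⟩
  · rintro ⟨a, ha⟩
    -- Since `ν` is nonzero, the a.e. constant is an actual value of `z`, where `g` equals `c`.
    obtain ⟨x, hx⟩ := ha.exists
    rw [average_congr ha, average_const, ← hx, hc]

theorem StrictConvexOn.map_average_openOrthant_eq_iff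
    (hg : StrictConvexOn ℝ (openOrthant m) g)
    (hgc : ContinuousOn g (openOrthant m)) (hz : Continuous z)
    (hpos : ∀ x, z x ∈ openOrthant m) (hc : ∀ x, g (z x) = c) :
    g (⨍ x, z x ∂ν) = c ↔ ∃ a, ∀ᵐ x ∂ν, z x = a := by
  rw [← hg.neg.map_average_openOrthant_eq_iff hgc.neg hz hpos fun x => congrArg Neg.neg (hc x),
    Pi.neg_apply, neg_inj]

end Jensen

/-! ### Mixed volumes as weighted averages -/

section Mixed

variable {n m : ℕ} {s : ℝ} {K : ConvexBody (EuclideanSpace ℝ (Fin n))}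

theorem continuous_mixedVolume_integrand
    (hK : (0 : EuclideanSpace ℝ (Fin n)) ∈ interior (K : Set (EuclideanSpace ℝ (Fin n))))
    {f : Metric.sphere (0 : EuclideanSpace ℝ (Fin n)) 1 → ℝ} (hf : Continuous f)
    (hpos : ∀ u, 0 < f u) : Continuous fun u => f u ^ s * supportFun K u ^ (1 - s) :=
  (hf.rpow_const fun u => Or.inl (hpos u).ne').mul
    ((continuous_supportFun K).rpow_const fun u => Or.inl (supportFun_pos hK u).ne')

theorem integral_mixedVolume_pos (hn : 1 ≤ n)
    (hK : (0 : EuclideanSpace ℝ (Fin n)) ∈ interior (K : Set (EuclideanSpace ℝ (Fin n))))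
    {f : Metric.sphere (0 : EuclideanSpace ℝ (Fin n)) 1 → ℝ} (hf : Continuous f)
    (hpos : ∀ u, 0 < f u) :
    0 < ∫ u, f u ^ s * supportFun K u ^ (1 - s) ∂(surfaceAreaMeasure K) := by
  have := isFiniteMeasure_surfaceAreaMeasure hn K
  have hw : ∀ u, 0 < f u ^ s * supportFun K u ^ (1 - s) := fun u =>
    mul_pos (Real.rpow_pos_of_pos (hpos u) _) (Real.rpow_pos_of_pos (supportFun_pos hK u) _)
  rw [integral_pos_iff_support_of_nonneg (fun u => (hw u).le)
    (continuous_mixedVolume_integrand hK hf hpos).integrable_of_compactSpace]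
  rw [Function.support_eq_univ fun u => (hw u).ne']
  exact Measure.measure_univ_pos.2 (surfaceAreaMeasure_ne_zero hn hK)

theorem mixedVolumeFun_pos (hn : 1 ≤ n)
    (hK : (0 : EuclideanSpace ℝ (Fin n)) ∈ interior (K : Set (EuclideanSpace ℝ (Fin n))))
    {f : Metric.sphere (0 : EuclideanSpace ℝ (Fin n)) 1 → ℝ} (hf : Continuous f)
    (hpos : ∀ u, 0 < f u) : 0 < mixedVolumeFun s K f :=
  mul_pos (one_div_pos.2 (Nat.cast_pos.2 hn)) (integral_mixedVolume_pos hn hK hf hpos)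

/-- The ratios of `L_s` mixed volumes are averages of `(p_j / h)^s` with respect to a measure
equivalent to the surface area measure. -/
theorem exists_measure_average_eq_mixedVolumeFun_div (hn : 1 ≤ n)
    (hK : (0 : EuclideanSpace ℝ (Fin n)) ∈ interior (K : Set (EuclideanSpace ℝ (Fin n))))
    {h : Metric.sphere (0 : EuclideanSpace ℝ (Fin n)) 1 → ℝ} (hh : Continuous h)
    (hpos : ∀ u, 0 < h u)
    {p : Fin m → Metric.sphere (0 : EuclideanSpace ℝ (Fin n)) 1 → ℝ}
    (hp : ∀ j, Continuous (p j)) (hppos : ∀ j u, 0 < p j u) :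
    ∃ ν : Measure (Metric.sphere (0 : EuclideanSpace ℝ (Fin n)) 1),
      IsFiniteMeasure ν ∧ NeZero ν ∧ ν ≪ surfaceAreaMeasure K ∧ surfaceAreaMeasure K ≪ ν ∧
      ⨍ u, (fun j => (p j u / h u) ^ s) ∂ν =
        fun j => mixedVolumeFun s K (p j) / mixedVolumeFun s K h := by
  have := isFiniteMeasure_surfaceAreaMeasure hn K
  set μ := surfaceAreaMeasure K
  -- The integrand of `V_s(K, h)`: multiplied by `(p_j / h)^s`, it becomes the integrand for `p_j`.
  -- Its positivity makes `ν` and `S_K` mutually absolutely continuous.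
  set w := fun u => h u ^ s * supportFun K u ^ (1 - s) with hwdef
  have hwc : Continuous w := continuous_mixedVolume_integrand hK hh hpos
  have hw : ∀ u, 0 < w u := fun u =>
    mul_pos (Real.rpow_pos_of_pos (hpos u) _) (Real.rpow_pos_of_pos (supportFun_pos hK u) _)
  have hwm : Measurable fun u => ENNReal.ofReal (w u) := hwc.measurable.ennreal_ofReal
  set ν := μ.withDensity fun u => ENNReal.ofReal (w u) with hν
  have hfin : IsFiniteMeasure ν :=
    isFiniteMeasure_withDensity_ofReal (hwc.integrable_of_compactSpace (ν := μ)).2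
  have hac : μ ≪ ν := withDensity_absolutelyContinuous' hwm.aemeasurable
    (Eventually.of_forall fun u => by simpa using hw u)
  have hint : ∀ f : Metric.sphere (0 : EuclideanSpace ℝ (Fin n)) 1 → ℝ,
      ∫ u, f u ∂ν = ∫ u, w u * f u ∂μ := by
    intro f
    rw [hν, integral_withDensity_eq_integral_toReal_smul hwm
      (Eventually.of_forall fun u => ENNReal.ofReal_lt_top)]
    exact integral_congr_ae (Eventually.of_forall fun u => by
      simp [ENNReal.toReal_ofReal (hw u).le])
  have hν0 : NeZero ν := ⟨fun h0 => surfaceAreaMeasure_ne_zero hn hK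
    (Measure.absolutelyContinuous_zero_iff.1 (h0 ▸ hac))⟩
  refine ⟨ν, hfin, hν0, withDensity_absolutelyContinuous _ _, hac, ?_⟩
  have hzc : ∀ j, Continuous fun u => (p j u / h u) ^ s := fun j =>
    ((hp j).div hh fun u => (hpos u).ne').rpow_const fun u =>
      Or.inl (div_pos (hppos j u) (hpos u)).ne'
  have hn0 : (1 / (n : ℝ)) ≠ 0 := one_div_ne_zero (Nat.cast_ne_zero.2 (by omega))
  have hν1 : ν.real univ = ∫ u, w u ∂μ := by
    have := hint fun _ => 1
    simpa using this
  ext j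
  rw [average_eq, hν1, Pi.smul_apply, smul_eq_mul,
    eval_integral fun j => (hzc j).integrable_of_compactSpace, hint, mixedVolumeFun,
    mixedVolumeFun, mul_div_mul_left _ _ hn0, inv_mul_eq_div]
  congr 1
  refine integral_congr_ae (Eventually.of_forall fun u => ?_)
  have h1 : h u ^ s ≠ 0 := (Real.rpow_pos_of_pos (hpos u) _).ne'
  simp only [hwdef]
  rw [Real.div_rpow (hppos j u).le (hpos u).le]
  field_simp

end Mixed

/-- The vector `((p_j / h)^s)_j`, with `h` the Orlicz sum, is almost everywhere constant if and
only if the `p_j` are proportional on the support of the measure. -/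
theorem exists_ae_eq_const_iff_proportional {m : ℕ} (hm : 0 < m) {s : ℝ} (hs : s ≠ 0)
    {X : Type*} [TopologicalSpace X] [HereditarilyLindelofSpace X] [MeasurableSpace X]
    {μ : Measure X}
    {φ : (Fin m → ℝ) → ℝ} (hφ : IsOrliczPhi φ ∨ IsOrliczPsi φ) {p : Fin m → X → ℝ}
    (hc : ∀ j, Continuous (p j)) (hp : ∀ j x, 0 < p j x) (hμ : μ ≠ 0) (i : Fin m) :
    (∃ a : Fin m → ℝ, ∀ᵐ x ∂μ, (fun j => (p j x / orliczSum φ p x) ^ s) = a) ↔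
      ∃ a : Fin m → ℝ, (∀ j, 0 < a j) ∧ ∀ j, ∀ x ∈ μ.support, p j x = a j * p i x := by
  have hpos : ∀ x, 0 < orliczSum φ p x := fun x => (orliczSum_spec hm hφ fun j => hp j x).1
  have heq : ∀ x, φ (fun j => p j x / orliczSum φ p x) = 1 := fun x =>
    (orliczSum_spec hm hφ fun j => hp j x).2
  constructor
  · rintro ⟨a, ha⟩
    have := ae_neBot.2 hμ
    obtain ⟨y, hy⟩ := ha.exists
    refine ⟨fun j => p j y / p i y, fun j => div_pos (hp j y) (hp i y), fun j => ?_⟩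
    -- The proportionality set is closed by continuity, so once it has full measure it contains the
    -- support.
    refine Measure.support_subset_of_isClosed
      (isClosed_eq (hc j) (continuous_const.mul (hc i))) ?_
    filter_upwards [ha] with x hx
    have key : ∀ j, p j x / orliczSum φ p x = p j y / orliczSum φ p y := fun j =>
      Real.rpow_left_injOn hs (div_pos (hp j x) (hpos x)).le (div_pos (hp j y) (hpos y)).le
        ((congrFun hx j).trans (congrFun hy j).symm)
    have hj := key j
    have hi := key i
    have h1 := (hpos x).ne'
    have h2 := (hpos y).ne'
    have h3 := (hp i y).ne'
    have h4 := (hp i x).ne'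
    change p j x = p j y / p i y * p i x
    calc p j x = p j x / orliczSum φ p x / (p i x / orliczSum φ p x) * p i x := by field_simp
      _ = p j y / p i y * p i x := by rw [hj, hi]; field_simp
  · rintro ⟨a, ha0, ha⟩
    -- By homogeneity, if `p_j = a_j p_i` at a point, the Orlicz sum there is `q p_i`, with `q` the
    -- Orlicz sum of the constants `a_j`.
    obtain ⟨q, ⟨hq0, hq⟩, -⟩ := existsUnique_orlicz hm hφ (z := a) ha0
    refine ⟨fun j => (a j / q) ^ s, ?_⟩
    filter_upwards [Measure.support_mem_ae (μ := μ)] with x hx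
    have h4 := (hp i x).ne'
    have hdiv : ∀ j, p j x / (q * p i x) = a j / q := fun j => by
      rw [ha j x hx]; field_simp
    have : orliczSum φ p x = q * p i x :=
      orliczSum_eq (existsUnique_orlicz hm hφ (z := fun j => p j x) fun j => hp j x)
        (mul_pos hq0 (hp i x)) (by simp_rw [hdiv]; exact hq)
    simp_rw [this, hdiv]


/-! ### The Orlicz inequality for mixed volumes and its equality case. -/

theorem mainTheorem8 {n m : ℕ} (hn : 1 ≤ n) (hm : 2 ≤ m) (s : ℝ) (hs : s ≠ 0)
    (K : ConvexBody (EuclideanSpace ℝ (Fin n)))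
    (L : Fin m → ConvexBody (EuclideanSpace ℝ (Fin n)))
    (hK : (0 : EuclideanSpace ℝ (Fin n)) ∈ interior (K : Set (EuclideanSpace ℝ (Fin n))))
    (hL : ∀ j, (0 : EuclideanSpace ℝ (Fin n)) ∈
      interior (L j : Set (EuclideanSpace ℝ (Fin n))))
    (φ : (Fin m → ℝ) → ℝ) (hφ : IsOrliczPhi φ ∨ IsOrliczPsi φ) :
    (∀ j, 0 < mixedVolume s K (L j)) ∧ 0 < mixedVolumeOrlicz s K φ L ∧
    (ConcaveOn ℝ (openOrthant m) (orliczPow s φ) →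
      1 ≤ orliczPow s φ (fun j => mixedVolume s K (L j) / mixedVolumeOrlicz s K φ L)) ∧
    (ConvexOn ℝ (openOrthant m) (orliczPow s φ) →
      orliczPow s φ (fun j => mixedVolume s K (L j) / mixedVolumeOrlicz s K φ L) ≤ 1) ∧
    (StrictConcaveOn ℝ (openOrthant m) (orliczPow s φ) ∨
        StrictConvexOn ℝ (openOrthant m) (orliczPow s φ) →
      (orliczPow s φ (fun j => mixedVolume s K (L j) / mixedVolumeOrlicz s K φ L) = 1 ↔
        ∃ a : Fin m → ℝ, (∀ j, 0 < a j) ∧ ∀ j, ∀ u ∈ (surfaceAreaMeasure K).support,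
          supportFun (L j) u = a j * supportFun (L ⟨0, by omega⟩) u) ∧
      ((surfaceAreaMeasure K).support = Set.univ →
        (orliczPow s φ (fun j => mixedVolume s K (L j) / mixedVolumeOrlicz s K φ L) = 1 ↔
          ∃ a : Fin m → ℝ, (∀ j, 0 < a j) ∧ ∀ j, ∀ u,
            supportFun (L j) u = a j * supportFun (L ⟨0, by omega⟩) u))) := by
  have hm0 : 0 < m := by omega
  set p : Fin m → Metric.sphere (0 : EuclideanSpace ℝ (Fin n)) 1 → ℝ :=
    fun j => supportFun (L j)
  have hpc : ∀ j, Continuous (p j) := fun j => continuous_supportFun (L j)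
  have hp : ∀ j u, 0 < p j u := fun j u => supportFun_pos (hL j) u
  have hspec := fun u => orliczSum_spec hm0 hφ (x := u) fun j => hp j u
  have hhc : Continuous (orliczSum φ p) := continuous_orliczSum hm0 hφ hp hpc
  have hh : ∀ u, 0 < orliczSum φ p u := fun u => (hspec u).1
  obtain ⟨ν, hνfin, hν0, hνμ, hμν, havg⟩ :=
    exists_measure_average_eq_mixedVolumeFun_div (s := s) hn hK hhc hh hpc hp
  have hzc : Continuous fun u => (fun j => (p j u / orliczSum φ p u) ^ s : Fin m → ℝ) :=
    continuous_pi fun j => ((hpc j).div hhc fun u => (hh u).ne').rpow_const fun u =>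
      Or.inl (div_pos (hp j u) (hh u)).ne'
  have hzpos : ∀ u, (fun j => (p j u / orliczSum φ p u) ^ s) ∈ openOrthant m := fun u j =>
    Real.rpow_pos_of_pos (div_pos (hp j u) (hh u)) _
  have hz1 : ∀ u, orliczPow s φ (fun j => (p j u / orliczSum φ p u) ^ s) = 1 := by
    intro u
    refine Eq.trans (congrArg φ (funext fun j => ?_)) (hspec u).2
    rw [one_div, Real.rpow_rpow_inv (div_pos (hp j u) (hh u)).le hs]
  have hgc := continuousOn_orliczPow s (continuousOn_openOrthant_of_orlicz hφ)
  have hratio : (fun j => mixedVolume s K (L j) / mixedVolumeOrlicz s K φ L) =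
      ⨍ u, (fun j => (p j u / orliczSum φ p u) ^ s) ∂ν := havg.symm
  have hiff : StrictConcaveOn ℝ (openOrthant m) (orliczPow s φ) ∨
        StrictConvexOn ℝ (openOrthant m) (orliczPow s φ) →
      (orliczPow s φ (fun j => mixedVolume s K (L j) / mixedVolumeOrlicz s K φ L) = 1 ↔
        ∃ a : Fin m → ℝ, (∀ j, 0 < a j) ∧ ∀ j, ∀ u ∈ (surfaceAreaMeasure K).support,
          supportFun (L j) u = a j * supportFun (L ⟨0, by omega⟩) u) := by
    intro hg
    rw [hratio, ← exists_ae_eq_const_iff_proportional hm0 hs hφ hpc hp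
      (surfaceAreaMeasure_ne_zero hn hK) ⟨0, by omega⟩]
    -- Jensen's equality case speaks of `ν`, proportionality of `S_K`; the two have the same null
    -- sets.
    have hae : ∀ a : Fin m → ℝ, (∀ᵐ u ∂ν, (fun j => (p j u / orliczSum φ p u) ^ s) = a) ↔
        ∀ᵐ u ∂(surfaceAreaMeasure K), (fun j => (p j u / orliczSum φ p u) ^ s) = a := fun a =>
      ⟨fun h => hμν.ae_le h, fun h => hνμ.ae_le h⟩
    simp_rw [← hae]
    exact hg.elim (fun hg => hg.map_average_openOrthant_eq_iff hgc hzc hzpos hz1)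
      fun hg => hg.map_average_openOrthant_eq_iff hgc hzc hzpos hz1
  refine ⟨fun j => mixedVolumeFun_pos hn hK (hpc j) (hp j), mixedVolumeFun_pos hn hK hhc hh,
    fun hg => ?_, fun hg => ?_, fun hg => ⟨hiff hg, fun hsupp => ?_⟩⟩
  · rw [hratio]
    exact hg.le_map_average_openOrthant hgc hzc hzpos hz1
  · rw [hratio]
    exact hg.map_average_openOrthant_le hgc hzc hzpos hz1
  · rw [hiff hg, hsupp]
    simp only [mem_univ, true_imp_iff]
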